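/- **Theorem 2.3 (Existence of minimal solutions).** Let $n\ge 1$, let $\Omega\subset\mathbb R^n$ be a bounded domain with smooth boundary, let $0\le\gamma<1$, $\alpha=\frac{4}{3+\gamma}$, $\delta>0$, and let $\mathcal B:\mathbb R\to\mathbb R$ be a Lipschitz function with $0\le\mathcal B(s)\le 1$ for $s\ge 0$, $\mathcal B(s)=0$ for $s\le\delta/2$ and $\mathcal B(s)=1$ for $s\ge\delta$. For $\varepsilon>0$ put $\mathcal B_\varepsilon(s)=\mathcal B(s/\varepsilon^\alpha)$, where $\mathcal B_\varepsilon(s)s^{-\gamma}$ is understood to be $0$ for $s\le 0$, and let $\Delta_\infty u=\sum_{i,j}D_{ij}u\,D_iu\,D_ju$. For each $\varepsilon>0$ let $\varphi_\varepsilon\in W^{2,\infty}(\partial\Omega)$ be a nonnegative boundary datum (identified with its continuous representative). Then, for each $\varepsilon>0$, the problem $$\Delta_\infty u=\mathcal B_\varepsilon(u)\,u^{-\gamma}\ \text{ in }\Omega,\qquad u=\varphi_\varepsilon\ \text{ on }\partial\Omega \tag{$P_\varepsilon$}$$ has a nonnegative minimal viscosity solution $u_\varepsilon\in C(\overline\Omega)$;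 minimal means that $u_\varepsilon\le w$ on $\overline\Omega$ for every viscosity supersolution $w\in C(\overline\Omega)$ of the equation with $w\ge\varphi_\varepsilon$ on $\partial\Omega$. Moreover, the family $\{u_\varepsilon\}$ is locally Lipschitz-equicontinuous as long as the boundary data stay bounded: if $S\subset(0,\infty)$ and $\sup_{\varepsilon\in S}\sup_{\partial\Omega}\varphi_\varepsilon<\infty$, then for every compact $K\subset\Omega$ there is a constant $L$ such that $|u_\varepsilon(x)-u_\varepsilon(y)|\le L|x-y|$ for all $x,y\in K$ and all $\varepsilon\in S$. -/

import Mathlib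

open Set Filter Topology MeasureTheory
open scoped ContDiff NNReal ENNReal

noncomputable section

namespace InfSingular

/-- `ℝⁿ` with its Euclidean norm. -/
abbrev E (n : ℕ) : Type := EuclideanSpace ℝ (Fin n)

/-- The `i`-th vector of the standard basis of `ℝⁿ`. -/
def e {n : ℕ} (i : Fin n) : E n := EuclideanSpace.single i 1

/-- A bounded domain with smooth boundary: near every boundary point, `Ω` is the sublevel set
`{ρ < 0}` of a smooth function `ρ` with nonvanishing differential at that point. -/
structure IsBoundedSmoothDomain {n : ℕ} (Ω : Set (E n)) : Prop where
  isOpen : IsOpen Ω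
  isConnected : IsConnected Ω
  isBounded : Bornology.IsBounded Ω
  smooth_boundary : ∀ x ∈ frontier Ω, ∃ (U : Set (E n)) (ρ : E n → ℝ),
    IsOpen U ∧ x ∈ U ∧ ContDiffOn ℝ ∞ ρ U ∧ fderiv ℝ ρ x ≠ 0 ∧ ∀ y ∈ U, (y ∈ Ω ↔ ρ y < 0)

/-! ### The Sobolev class `W^{2,∞}` -/

/-- `g` is the weak partial derivative of `f` in the direction of `e i` on the open set `V`
(used for `f` and `g` in `L^∞(V)`, so that all integrals converge). -/
def IsWeakPartial {m : ℕ} (V : Set (E m)) (i : Fin m) (f g : E m → ℝ) : Prop :=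
  ∀ ζ : E m → ℝ, ContDiff ℝ ∞ ζ → HasCompactSupport ζ → tsupport ζ ⊆ V →
    ∫ x in V, f x * fderiv ℝ ζ x (e i) = - ∫ x in V, g x * ζ x

/-- `f ∈ W^{2,∞}(V)`: `f` and its weak derivatives of order one and two are in `L^∞(V)`. -/
def MemW2Inf {m : ℕ} (V : Set (E m)) (f : E m → ℝ) : Prop :=
  MemLp f ∞ (volume.restrict V) ∧
  ∃ (g : Fin m → E m → ℝ) (h : Fin m → Fin m → E m → ℝ),
    (∀ i, MemLp (g i) ∞ (volume.restrict V) ∧ IsWeakPartial V i f (g i)) ∧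
    (∀ i j, MemLp (h i j) ∞ (volume.restrict V) ∧ IsWeakPartial V j (g i) (h i j))

/-- `ψ : V → ∂Ω` is a smooth local parametrization of the hypersurface `∂Ω`: an injective immersion
of an open set of `ℝ^{n-1}` into `∂Ω`. (As `∂Ω` has dimension `n - 1`, such a map is a
diffeomorphism onto an open part of `∂Ω`.) -/
structure IsBoundaryParametrization {n : ℕ} (Ω : Set (E n)) (V : Set (E (n - 1)))
    (ψ : E (n - 1) → E n) : Prop where
  isOpen : IsOpen V
  contDiffOn : ContDiffOn ℝ ∞ ψ V
  mapsTo : MapsTo ψ V (frontier Ω)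
  injOn : InjOn ψ V
  immersion : ∀ y ∈ V, Function.Injective (fderiv ℝ ψ y)

/-- `φ ∈ W^{2,∞}(∂Ω)` (its continuous representative): `φ` is continuous on `∂Ω`, and around every
boundary point it is of class `W^{2,∞}` in some smooth local parametrization of `∂Ω`. -/
def MemW2InfBoundary {n : ℕ} (Ω : Set (E n)) (φ : E n → ℝ) : Prop :=
  ContinuousOn φ (frontier Ω) ∧
  ∀ x ∈ frontier Ω, ∃ (V : Set (E (n - 1))) (ψ : E (n - 1) → E n),
    IsBoundaryParametrization Ω V ψ ∧ x ∈ ψ '' V ∧ MemW2Inf V (φ ∘ ψ)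

/-! ### The infinity Laplacian and viscosity solutions of `Δ_∞ u = G(u)` -/

/-- `Δ_∞ f (x) = ∑_{i,j} D_{ij} f (x) D_i f (x) D_j f (x)`. -/
def infLaplacian {n : ℕ} (f : E n → ℝ) (x : E n) : ℝ :=
  ∑ i, ∑ j, fderiv ℝ (fderiv ℝ f) x (e i) (e j) * fderiv ℝ f x (e i) * fderiv ℝ f x (e j)

/-- Continuous viscosity subsolution of `Δ_∞ u = G(u)` in the open set `Ω`. -/
def IsViscositySubsolution {n : ℕ} (Ω : Set (E n)) (G : ℝ → ℝ) (u : E n → ℝ) : Prop :=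
  ContinuousOn u Ω ∧ ∀ x ∈ Ω, ∀ η : E n → ℝ, ContDiffAt ℝ 2 η x →
    IsLocalMax (fun y => u y - η y) x → G (u x) ≤ infLaplacian η x

/-- Continuous viscosity supersolution of `Δ_∞ u = G(u)` in the open set `Ω`. -/
def IsViscositySupersolution {n : ℕ} (Ω : Set (E n)) (G : ℝ → ℝ) (u : E n → ℝ) : Prop :=
  ContinuousOn u Ω ∧ ∀ x ∈ Ω, ∀ η : E n → ℝ, ContDiffAt ℝ 2 η x →
    IsLocalMin (fun y => u y - η y) x → infLaplacian η x ≤ G (u x)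

/-- `u ∈ C(closure Ω)` is a viscosity solution of `Δ_∞ u = G(u)` in `Ω`, `u = φ` on `∂Ω`. -/
structure IsDirichletSolution {n : ℕ} (Ω : Set (E n)) (G : ℝ → ℝ) (φ u : E n → ℝ) : Prop where
  continuousOn : ContinuousOn u (closure Ω)
  subsolution : IsViscositySubsolution Ω G u
  supersolution : IsViscositySupersolution Ω G u
  boundary : ∀ x ∈ frontier Ω, u x = φ x

/-- A minimal (Perron) solution of the Dirichlet problem: a solution that lies below every
supersolution in `C(closure Ω)` whose boundary values are at least `φ`. -/
structure IsMinimalSolution {n : ℕ} (Ω : Set (E n)) (G : ℝ → ℝ) (φ u : E n → ℝ) : Prop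
    extends IsDirichletSolution Ω G φ u where
  minimal : ∀ w : E n → ℝ, ContinuousOn w (closure Ω) → IsViscositySupersolution Ω G w →
    (∀ x ∈ frontier Ω, φ x ≤ w x) → ∀ x ∈ closure Ω, u x ≤ w x

/-! ### The penalized source term -/

/-- The conditions on the profile `B` with threshold `δ`. -/
structure IsPenalizationProfile (δ : ℝ) (B : ℝ → ℝ) : Prop where
  lipschitz : ∃ L : ℝ≥0, LipschitzWith L B
  mem_Icc : ∀ s, 0 ≤ s → 0 ≤ B s ∧ B s ≤ 1
  eq_zero : ∀ s, s ≤ δ / 2 → B s = 0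
  eq_one : ∀ s, δ ≤ s → B s = 1

/-- The source term `s ↦ B_ε(s) s^{-γ}`, where `B_ε(s) = B(s / ε^α)` and `α = 4 / (3 + γ)`. For the
profiles in use it vanishes for `s ≤ δ ε^α / 2`, in particular for `s ≤ 0`. -/
def penalizedSource (γ : ℝ) (B : ℝ → ℝ) (ε : ℝ) (s : ℝ) : ℝ :=
  B (s / ε ^ (4 / (3 + γ))) * s ^ (-γ)

/-- The functions `u ε`, `ε ∈ S`, are locally Lipschitz in `Ω` uniformly in `ε`. -/
def LocallyEquiLipschitzOn {n : ℕ} (Ω : Set (E n)) (S : Set ℝ) (u : ℝ → E n → ℝ) : Prop :=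
  ∀ K : Set (E n), IsCompact K → K ⊆ Ω → ∃ L : ℝ≥0, ∀ ε ∈ S, LipschitzOnWith L (u ε) K

end InfSingular

end

namespace InfSingular

open scoped RealInnerProductSpace

/-! ### Calculus of the infinity Laplacian -/

section Calculus

variable {n : ℕ}

/-! The solution is the infimum `perron` of all admissible supersolutions, so minimality is
automatic. The source need not be monotone in `u`, and no general comparison principle is used: a
supersolution is only compared with smooth strict subsolutions (`le_of_strict_subsolution`), which
may serve as test functions. The explicit barriers are radial functions, whose infinity Laplacian is
given by `infLaplacian_radial`.

Perturbing competitors shows that the infimum passes both viscosity tests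
(`perron_subsolution_test`, `perron_supersolution_test`). At that stage it is only upper
semicontinuous. But the source is nonnegative, so the infimum is infinity-subharmonic, and
comparison with cones (`le_cone_of_infLaplacian_nonneg`) makes it locally Lipschitz. The constant is
`M / r`, with `M` a bound for the boundary data and `r` a radius of balls that stay in `Ω`; it does
not see `ε`, whence the uniform estimate. Barriers with vertex on the boundary give the boundary
values and continuity up to the boundary. -/

theorem infLaplacian_eq_of_gradient {f : E n → ℝ} {x d : E n}
    (h : ∀ v, fderiv ℝ f x v = ⟪d, v⟫) :
    infLaplacian f x = fderiv ℝ (fderiv ℝ f) x d d := by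
  have hi : ∀ i, fderiv ℝ f x (e i) = d i := by
    intro i
    rw [h, e, EuclideanSpace.inner_single_right]
    simp
  have hd : d = ∑ i, d i • e i := by
    ext j
    simp [e, Pi.single_apply]
  conv_rhs => rw [hd]
  simp only [infLaplacian, hi, map_sum, sum_apply, map_smul,
    smul_apply, smul_eq_mul, Finset.mul_sum]
  rw [Finset.sum_comm]
  refine Finset.sum_congr rfl fun i _ => Finset.sum_congr rfl fun j _ => ?_
  ring

theorem infLaplacian_eq_gradient (f : E n → ℝ) (x : E n) :
    infLaplacian f x = fderiv ℝ (fderiv ℝ f) x (gradient f x) (gradient f x) :=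
  infLaplacian_eq_of_gradient fun v => by
    simp [gradient]

theorem continuousAt_infLaplacian {f : E n → ℝ} {x : E n} (hf : ContDiffAt ℝ 2 f x) :
    ContinuousAt (infLaplacian f) x := by
  have h1 : ContDiffAt ℝ 1 (fderiv ℝ f) x := hf.fderiv_right (by norm_num)
  have h2 : ContinuousAt (fderiv ℝ (fderiv ℝ f)) x :=
    (h1.fderiv_right (m := 0) (by norm_num)).continuousAt
  have h1' := h1.continuousAt
  unfold infLaplacian
  fun_prop

theorem differentiableAt_fderiv {f : E n → ℝ} {x : E n} (hf : ContDiffAt ℝ 2 f x) :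
    DifferentiableAt ℝ (fderiv ℝ f) x :=
  (hf.fderiv_right (m := 1) (by norm_num)).differentiableAt (by norm_num)

theorem eventually_differentiableAt {f : E n → ℝ} {x : E n} (hf : ContDiffAt ℝ 2 f x) :
    ∀ᶠ y in 𝓝 x, DifferentiableAt ℝ f y :=
  (hf.eventually (by simp)).mono fun _ hy => hy.differentiableAt (by norm_num)

theorem tendsto_line (x d : E n) : Tendsto (fun t : ℝ => x + t • d) (𝓝 0) (𝓝 x) := by
  have : ContinuousAt (fun t : ℝ => x + t • d) 0 := by fun_prop
  simpa [ContinuousAt] using this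

theorem hasDerivAt_line (x d : E n) (t : ℝ) : HasDerivAt (fun t : ℝ => x + t • d) d t := by
  simpa using ((hasDerivAt_id t).smul_const d).const_add x

theorem eventually_hasDerivAt_comp_line {f : E n → ℝ} {x : E n} (hf : ContDiffAt ℝ 2 f x)
    (d : E n) :
    ∀ᶠ t in 𝓝 (0 : ℝ), HasDerivAt (fun t : ℝ => f (x + t • d)) (fderiv ℝ f (x + t • d) d) t := by
  filter_upwards [(tendsto_line x d).eventually (eventually_differentiableAt hf)] with t ht
  exact ht.hasFDerivAt.comp_hasDerivAt t (hasDerivAt_line x d t)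

theorem hasDerivAt_fderiv_comp_line {f : E n → ℝ} {x : E n} (hf : ContDiffAt ℝ 2 f x)
    (d : E n) :
    HasDerivAt (fun t : ℝ => fderiv ℝ f (x + t • d) d) (fderiv ℝ (fderiv ℝ f) x d d) 0 := by
  have h1 : HasDerivAt (fun t : ℝ => fderiv ℝ f (x + t • d)) (fderiv ℝ (fderiv ℝ f) x d) 0 :=
    (differentiableAt_fderiv hf).hasFDerivAt.comp_hasDerivAt_of_eq 0 (hasDerivAt_line x d 0)
      (by simp)
  exact (ContinuousLinearMap.apply ℝ ℝ d).hasFDerivAt.comp_hasDerivAt 0 h1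

theorem deriv_deriv_comp_line {f : E n → ℝ} {x : E n} (hf : ContDiffAt ℝ 2 f x) (d : E n) :
    deriv (deriv fun t : ℝ => f (x + t • d)) 0 = fderiv ℝ (fderiv ℝ f) x d d := by
  rw [← (hasDerivAt_fderiv_comp_line hf d).deriv]
  refine EventuallyEq.deriv_eq ?_
  filter_upwards [eventually_hasDerivAt_comp_line hf d] with t ht using ht.deriv

/-- The second order necessary condition at a local minimum. -/
theorem fderiv_fderiv_nonneg_of_isLocalMin {f : E n → ℝ} {x : E n} (hf : ContDiffAt ℝ 2 f x)
    (hmin : IsLocalMin f x) (d : E n) : 0 ≤ fderiv ℝ (fderiv ℝ f) x d d := by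
  by_contra! hneg
  set g : ℝ → ℝ := fun t => f (x + t • d) with hg
  have hgmin : IsLocalMin g 0 := by
    have := (tendsto_line x d).eventually hmin
    filter_upwards [this] with t ht
    simpa [hg] using ht
  have hgc : ContinuousAt g 0 :=
    (eventually_hasDerivAt_comp_line hf d).self_of_nhds.continuousAt
  rw [← deriv_deriv_comp_line hf d] at hneg
  -- A negative second derivative makes the minimum a maximum as well, so `g` is locally constant
  -- and that derivative vanishes.
  have hgmax : IsLocalMax g 0 :=
    isLocalMax_of_deriv_deriv_neg hneg hgmin.deriv_eq_zero hgc
  have hconst : g =ᶠ[𝓝 0] fun _ => g 0 := by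
    filter_upwards [hgmin, hgmax] with t h1 h2 using le_antisymm h2 h1
  have h1 : deriv g =ᶠ[𝓝 0] fun _ => 0 := by
    filter_upwards [hconst.eventuallyEq_nhds] with t ht
    rw [ht.deriv_eq]
    simp
  rw [h1.deriv_eq] at hneg
  simp at hneg

theorem fderiv_add_of_contDiffAt {f g : E n → ℝ} {x : E n} (hf : ContDiffAt ℝ 2 f x)
    (hg : ContDiffAt ℝ 2 g x) :
    fderiv ℝ (fun y => f y + g y) x = fderiv ℝ f x + fderiv ℝ g x ∧
    fderiv ℝ (fderiv ℝ fun y => f y + g y) x =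
      fderiv ℝ (fderiv ℝ f) x + fderiv ℝ (fderiv ℝ g) x := by
  have hev : fderiv ℝ (fun y => f y + g y) =ᶠ[𝓝 x] fun y => fderiv ℝ f y + fderiv ℝ g y := by
    filter_upwards [eventually_differentiableAt hf, eventually_differentiableAt hg] with y h1 h2
    exact fderiv_fun_add h1 h2
  refine ⟨hev.self_of_nhds, ?_⟩
  rw [hev.fderiv_eq]
  exact fderiv_fun_add (differentiableAt_fderiv hf) (differentiableAt_fderiv hg)

/-- The infinity Laplacian is degenerate elliptic. -/
theorem infLaplacian_le_of_isLocalMin_sub {g η : E n → ℝ} {x : E n} (hg : ContDiffAt ℝ 2 g x)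
    (hη : ContDiffAt ℝ 2 η x) (hmin : IsLocalMin (fun y => g y - η y) x) :
    infLaplacian η x ≤ infLaplacian g x := by
  have hdiff : ContDiffAt ℝ 2 (fun y => g y - η y) x := hg.sub hη
  obtain ⟨h1, h2⟩ := fderiv_add_of_contDiffAt hdiff hη
  simp only [sub_add_cancel] at h1 h2
  rw [hmin.fderiv_eq_zero, zero_add] at h1
  have hgrad : gradient g x = gradient η x := by
    unfold gradient
    exact congrArg _ h1
  rw [infLaplacian_eq_gradient, infLaplacian_eq_gradient, hgrad]
  have h3 := fderiv_fderiv_nonneg_of_isLocalMin hdiff hmin (gradient η x)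
  have h4 := congrArg (fun T => T (gradient η x) (gradient η x)) h2
  simp only [add_apply] at h4
  linarith

theorem hasFDerivAt_norm_sub_sq (z x : E n) :
    HasFDerivAt (fun y => ‖y - z‖ ^ 2) (2 • innerSL ℝ (x - z)) x :=
  ((hasFDerivAt_id x).sub_const z).norm_sq

theorem contDiff_quartic (c s : ℝ) (z : E n) :
    ContDiff ℝ 2 fun y : E n => c + s * (‖y - z‖ ^ 2) ^ 2 := by
  have : ContDiff ℝ 2 fun y : E n => ‖y - z‖ ^ 2 := (contDiff_id.sub contDiff_const).norm_sq ℝ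
  fun_prop

/-- The first two derivatives of the quartic vanish at `x`. Hence it can make a touching strict
without changing the operator there. -/
theorem infLaplacian_add_quartic {η : E n → ℝ} {x : E n} (hη : ContDiffAt ℝ 2 η x) (c s : ℝ) :
    infLaplacian (fun y => η y + (c + s * (‖y - x‖ ^ 2) ^ 2)) x = infLaplacian η x := by
  obtain ⟨h1, h2⟩ := fderiv_add_of_contDiffAt hη (contDiff_quartic c s x).contDiffAt
  have hq : fderiv ℝ (fun y : E n => c + s * (‖y - x‖ ^ 2) ^ 2) =
      fun y => (4 * s * ‖y - x‖ ^ 2) • innerSL ℝ (y - x) := by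
    funext y
    refine HasFDerivAt.fderiv ?_
    have h := (((hasFDerivAt_norm_sub_sq x y).pow 2).const_mul s).const_add c
    refine h.congr_fderiv ?_
    ext v
    simp
    ring
  have hq1 : fderiv ℝ (fun y : E n => c + s * (‖y - x‖ ^ 2) ^ 2) x = 0 := by
    rw [hq]; simp
  have hq2 : fderiv ℝ (fderiv ℝ fun y : E n => c + s * (‖y - x‖ ^ 2) ^ 2) x = 0 := by
    rw [hq]
    refine HasFDerivAt.fderiv ?_
    have ha := (hasFDerivAt_norm_sub_sq x x).const_mul (4 * s)
    have hb : HasFDerivAt (fun y : E n => innerSL ℝ (y - x)) (innerSL ℝ) x :=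
      (innerSL ℝ).hasFDerivAt.comp x ((hasFDerivAt_id x).sub_const x)
    refine (ha.smul hb).congr_fderiv ?_
    ext v w
    simp
  rw [hq1, add_zero] at h1
  rw [hq2, add_zero] at h2
  simp only [infLaplacian, h1, h2]

theorem contDiffAt_radial (c A b : ℝ) {z x : E n} (hx : x ≠ z) :
    ContDiffAt ℝ 2 (fun y => c + A * ‖y - z‖ + b * ‖y - z‖ ^ 2) x := by
  have : ContDiffAt ℝ 2 (fun y => ‖y - z‖) x :=
    (contDiffAt_id.sub contDiffAt_const).norm ℝ (sub_ne_zero.2 hx)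
  fun_prop

/-- The gradient points along the ray from `z`, so only the profile `h(t) = c + A t + b t²` matters
and the operator is `h'' (h')²`. Its sign is that of `b` wherever the slope is nonzero. -/
theorem infLaplacian_radial (c A b : ℝ) {z x : E n} (hx : x ≠ z) :
    infLaplacian (fun y => c + A * ‖y - z‖ + b * ‖y - z‖ ^ 2) x =
      2 * b * (A + 2 * b * ‖x - z‖) ^ 2 := by
  set f : E n → ℝ := fun y => c + A * ‖y - z‖ + b * ‖y - z‖ ^ 2 with hf
  have hpos : 0 < ‖x - z‖ := norm_pos_iff.2 (sub_ne_zero.2 hx)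
  have hfc : ContDiffAt ℝ 2 f x := contDiffAt_radial c A b hx
  have hnorm : HasFDerivAt (fun y => ‖y - z‖) (‖x - z‖⁻¹ • innerSL ℝ (x - z)) x := by
    have h := (hasFDerivAt_norm_sub_sq z x).sqrt (pow_ne_zero 2 hpos.ne')
    simp only [Real.sqrt_sq (norm_nonneg _)] at h
    refine h.congr_fderiv ?_
    ext v
    simp
    field_simp
  have hfd : ∀ v, fderiv ℝ f x v = ⟪(A / ‖x - z‖ + 2 * b) • (x - z), v⟫ := by
    intro v
    have h := ((hnorm.const_mul A).const_add c).add ((hasFDerivAt_norm_sub_sq z x).const_mul b)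
    have h' : HasFDerivAt f _ x := h
    rw [h'.fderiv, inner_smul_left]
    simp [inner_sub_left]
    ring
  have hline : (fun t : ℝ => f (x + t • (x - z))) =ᶠ[𝓝 0]
      fun t => c + A * ((1 + t) * ‖x - z‖) + b * ((1 + t) * ‖x - z‖) ^ 2 := by
    filter_upwards [lt_mem_nhds (show (-1 : ℝ) < 0 by norm_num)] with t ht
    have : x + t • (x - z) - z = (1 + t) • (x - z) := by module
    simp only [hf, this, norm_smul, Real.norm_eq_abs, abs_of_pos (show 0 < 1 + t by linarith)]
  have hdd : fderiv ℝ (fderiv ℝ f) x (x - z) (x - z) = 2 * b * ‖x - z‖ ^ 2 := by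
    rw [← deriv_deriv_comp_line hfc, (hline.deriv).deriv_eq]
    have : deriv (fun t : ℝ => c + A * ((1 + t) * ‖x - z‖) + b * ((1 + t) * ‖x - z‖) ^ 2) =
        fun t => A * ‖x - z‖ + 2 * b * ‖x - z‖ ^ 2 * (1 + t) := by
      funext t
      have h0 : HasDerivAt (fun t : ℝ => (1 + t) * ‖x - z‖) (1 * ‖x - z‖) t :=
        ((hasDerivAt_id t).const_add 1).mul_const _
      have h := ((h0.const_mul A).const_add c).add ((h0.pow 2).const_mul b)
      refine (h.congr_deriv ?_).deriv
      norm_num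
      ring
    rw [this]
    have h1 : HasDerivAt (fun t : ℝ => A * ‖x - z‖ + 2 * b * ‖x - z‖ ^ 2 * (1 + t))
        (2 * b * ‖x - z‖ ^ 2 * 1) 0 :=
      (((hasDerivAt_id (0 : ℝ)).const_add 1).const_mul _).const_add _
    rw [h1.deriv, mul_one]
  rw [infLaplacian_eq_of_gradient hfd]
  simp only [map_smul, smul_apply, smul_eq_mul, hdd]
  field_simp

end Calculus

end InfSingular

namespace InfSingular

/-! ### Viscosity supersolutions and comparison with strict subsolutions -/

section Comparison

variable {n : ℕ} {Ω : Set (E n)} {G : ℝ → ℝ}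

/-- The viscosity supersolution test for `Δ_∞ u = G(u)` at the point `x`. -/
def SupersolutionTestAt (G : ℝ → ℝ) (u : E n → ℝ) (x : E n) : Prop :=
  ∀ η : E n → ℝ, ContDiffAt ℝ 2 η x → IsLocalMin (fun y => u y - η y) x →
    infLaplacian η x ≤ G (u x)

theorem SupersolutionTestAt.congr {u v : E n → ℝ} {x : E n} (hu : SupersolutionTestAt G u x)
    (h : v =ᶠ[𝓝 x] u) : SupersolutionTestAt G v x := by
  intro η hη hmin
  rw [h.self_of_nhds]
  refine hu η hη ?_
  filter_upwards [hmin, h] with y hy1 hy2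
  simpa only [hy2, h.self_of_nhds] using hy1

theorem SupersolutionTestAt.min {u v : E n → ℝ} {x : E n} (hu : SupersolutionTestAt G u x)
    (hv : SupersolutionTestAt G v x) : SupersolutionTestAt G (fun y => min (u y) (v y)) x := by
  intro η hη hmin
  rcases le_total (u x) (v x) with h | h
  · simp only [min_eq_left h]
    refine hu η hη ?_
    filter_upwards [hmin] with y hy
    simp only [min_eq_left h] at hy
    linarith [min_le_left (u y) (v y)]
  · simp only [min_eq_right h]
    refine hv η hη ?_
    filter_upwards [hmin] with y hy
    simp only [min_eq_right h] at hy
    linarith [min_le_right (u y) (v y)]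

/-- A classical supersolution passes the viscosity test. -/
theorem supersolutionTestAt_of_contDiffAt {g : E n → ℝ} {x : E n} (hg : ContDiffAt ℝ 2 g x)
    (h : infLaplacian g x ≤ G (g x)) : SupersolutionTestAt G g x :=
  fun _ hη hmin => (infLaplacian_le_of_isLocalMin_sub hg hη hmin).trans h

theorem notMem_of_mem_frontier (hΩ : IsOpen Ω) {x : E n} (hx : x ∈ frontier Ω) : x ∉ Ω := by
  rw [hΩ.frontier_eq] at hx
  exact hx.2

theorem mem_frontier_of_notMem (hΩ : IsOpen Ω) {x : E n} (hx : x ∈ closure Ω) (hx' : x ∉ Ω) :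
    x ∈ frontier Ω := by
  rw [hΩ.frontier_eq]
  exact ⟨hx, hx'⟩

/-- A classical function that is a strict subsolution wherever it exceeds the supersolution `w`
does not exceed `w` at all, if it does not on the boundary. -/
theorem le_of_strict_subsolution (hΩ : IsOpen Ω) (hΩb : Bornology.IsBounded Ω) {w v : E n → ℝ}
    (hwc : ContinuousOn w (closure Ω)) (hw : ∀ x ∈ Ω, SupersolutionTestAt G w x)
    (hvc : ContinuousOn v (closure Ω)) (hv : ∀ x ∈ Ω, ContDiffAt ℝ 2 v x)
    (hbd : ∀ x ∈ frontier Ω, v x ≤ w x)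
    (hstrict : ∀ x ∈ Ω, w x < v x → G (w x) < infLaplacian v x) :
    ∀ x ∈ closure Ω, v x ≤ w x := by
  intro x hx
  by_contra! hlt
  -- At a negative minimum of `w - v`, necessarily interior, `v` itself is a test function for `w`.
  obtain ⟨z, hz, hmin⟩ := hΩb.isCompact_closure.exists_isMinOn ⟨x, hx⟩ (hwc.sub hvc)
  have hzx : w z - v z ≤ w x - v x := hmin hx
  have hzΩ : z ∈ Ω := by
    by_contra h
    linarith [hbd z (mem_frontier_of_notMem hΩ hz h)]
  have hloc : IsLocalMin (fun y => w y - v y) z := by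
    filter_upwards [hΩ.mem_nhds hzΩ] with y hy using hmin (subset_closure hy)
  exact absurd (hw z hzΩ v (hv z hzΩ) hloc) (not_le.2 (hstrict z hzΩ (by linarith)))

/-- A bounded nonnegative continuous source term that vanishes on `(-∞, 0]`. -/
structure IsBoundedSource (G : ℝ → ℝ) : Prop where
  continuous : Continuous G
  nonneg : ∀ s, 0 ≤ G s
  bounded : ∃ m, ∀ s, G s ≤ m
  eq_zero : ∀ s, s ≤ 0 → G s = 0

/-- The competitors in Perron's method: supersolutions in `C(closure Ω)` that lie above `φ` on
the boundary. -/
structure IsAdmissible (Ω : Set (E n)) (G : ℝ → ℝ) (φ w : E n → ℝ) : Prop where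
  continuousOn : ContinuousOn w (closure Ω)
  test : ∀ x ∈ Ω, SupersolutionTestAt G w x
  boundary : ∀ x ∈ frontier Ω, φ x ≤ w x

variable {φ : E n → ℝ}

theorem IsAdmissible.min {v w : E n → ℝ} (hv : IsAdmissible Ω G φ v)
    (hw : IsAdmissible Ω G φ w) : IsAdmissible Ω G φ (fun y => min (v y) (w y)) where
  continuousOn := hv.continuousOn.inf hw.continuousOn
  test x hx := (hv.test x hx).min (hw.test x hx)
  boundary x hx := le_min (hv.boundary x hx) (hw.boundary x hx)

theorem isAdmissible_const (hG : IsBoundedSource G) {M : ℝ} (hM : ∀ x ∈ frontier Ω, φ x ≤ M) :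
    IsAdmissible Ω G φ fun _ => M where
  continuousOn := continuousOn_const
  test _ _ := supersolutionTestAt_of_contDiffAt contDiffAt_const
    (by simpa [infLaplacian] using hG.nonneg M)
  boundary := hM

theorem continuous_radial (c A b : ℝ) (z : E n) :
    Continuous fun y => c + A * ‖y - z‖ + b * ‖y - z‖ ^ 2 := by
  fun_prop

theorem exists_norm_sub_le_of_isBounded (hΩb : Bornology.IsBounded Ω) (z : E n) :
    ∃ R > 0, ∀ y ∈ closure Ω, ‖y - z‖ ≤ R := by
  obtain ⟨R, hR, h⟩ := hΩb.closure.subset_closedBall_lt 0 z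
  exact ⟨R, hR, fun y hy => by simpa [dist_eq_norm] using h hy⟩

theorem IsAdmissible.nonneg (hΩ : IsOpen Ω) (hΩb : Bornology.IsBounded Ω)
    {z : E n} (hz : z ∉ Ω) (hG : IsBoundedSource G) (hφ : ∀ x ∈ frontier Ω, 0 ≤ φ x)
    {w : E n → ℝ} (hw : IsAdmissible Ω G φ w) : ∀ x ∈ closure Ω, 0 ≤ w x := by
  intro x hx
  obtain ⟨R, hR, hRle⟩ := exists_norm_sub_le_of_isBounded hΩb z
  refine le_of_forall_pos_sub_le fun κ hκ => ?_
  -- With this `s` the paraboloid is nonpositive on the closure; where it exceeds `w`, the source at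
  -- `w` vanishes. Its vertex lies outside `Ω`, so its infinity Laplacian is positive in `Ω`.
  set s := κ / R ^ 2 with hs
  have hs0 : 0 < s := by positivity
  have hv : ∀ y ∈ closure Ω, -κ + 0 * ‖y - z‖ + s * ‖y - z‖ ^ 2 ≤ 0 := by
    intro y hy
    have h1 : ‖y - z‖ ^ 2 ≤ R ^ 2 := pow_le_pow_left₀ (norm_nonneg _) (hRle y hy) 2
    have h2 : s * ‖y - z‖ ^ 2 ≤ s * R ^ 2 := mul_le_mul_of_nonneg_left h1 hs0.le
    have h3 : s * R ^ 2 = κ := by rw [hs]; field_simp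
    linarith
  have hne : ∀ y ∈ Ω, y ≠ z := fun y hy h => hz (h ▸ hy)
  have := le_of_strict_subsolution hΩ hΩb hw.continuousOn hw.test
    (continuous_radial (-κ) 0 s z).continuousOn
    (fun y hy => contDiffAt_radial _ _ _ (hne y hy))
    (fun y hy => (hv y (frontier_subset_closure hy)).trans ((hφ y hy).trans (hw.boundary y hy)))
    (fun y hy hlt => by
      rw [infLaplacian_radial _ _ _ (hne y hy),
        hG.eq_zero _ (hlt.le.trans (hv y (subset_closure hy)))]
      have : 0 < ‖y - z‖ := norm_pos_iff.2 (sub_ne_zero.2 (hne y hy))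
      positivity) x hx
  have h0 : 0 ≤ s * ‖x - z‖ ^ 2 := by positivity
  simp only [zero_mul, add_zero] at this
  linarith

/-- A continuous function on a compact set lies between two cones with vertex near its value at a
given point. -/
theorem exists_abs_sub_le_cone {K : Set (E n)} (hK : IsCompact K) {f : E n → ℝ}
    (hf : ContinuousOn f K) {x : E n} (hx : x ∈ K) {κ : ℝ} (hκ : 0 < κ) :
    ∃ A, 0 ≤ A ∧ ∀ y ∈ K, |f y - f x| ≤ κ + A * ‖y - x‖ := by
  obtain ⟨C, hC⟩ := hK.exists_bound_of_continuousOn hf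
  obtain ⟨r, hr, hlt⟩ := Metric.continuousOn_iff.1 hf x hx κ hκ
  have hC0 : 0 ≤ C := (norm_nonneg _).trans (hC x hx)
  refine ⟨2 * C / r, by positivity, fun y hy => ?_⟩
  by_cases hd : dist y x < r
  · have h1 := (hlt y hy hd).le
    rw [Real.dist_eq] at h1
    have : 0 ≤ 2 * C / r * ‖y - x‖ := by positivity
    linarith
  · have h1 : r ≤ ‖y - x‖ := by rw [← dist_eq_norm]; exact not_lt.1 hd
    have h2 : |f y - f x| ≤ 2 * C := by
      have := hC y hy
      have := hC x hx
      have := abs_sub (f y) (f x)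
      simp only [Real.norm_eq_abs] at *
      linarith
    have h3 : 2 * C ≤ 2 * C / r * ‖y - x‖ := by
      rw [div_mul_eq_mul_div, le_div_iff₀ hr]
      exact mul_le_mul_of_nonneg_left h1 (by positivity)
    linarith

theorem isCompact_frontier (hΩb : Bornology.IsBounded Ω) : IsCompact (frontier Ω) :=
  hΩb.isCompact_closure.of_isClosed_subset isClosed_frontier frontier_subset_closure

/-- Cones with vertex on the boundary are upper barriers. -/
theorem exists_isAdmissible_cone (hΩ : IsOpen Ω) (hΩb : Bornology.IsBounded Ω)
    (hG : IsBoundedSource G) (hφc : ContinuousOn φ (frontier Ω)) {x : E n} (hx : x ∈ frontier Ω)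
    {κ : ℝ} (hκ : 0 < κ) :
    ∃ A, IsAdmissible Ω G φ fun y => φ x + κ + A * ‖y - x‖ := by
  obtain ⟨A, -, hA⟩ := exists_abs_sub_le_cone (isCompact_frontier hΩb) hφc hx hκ
  refine ⟨A, Continuous.continuousOn (by fun_prop), fun y hy => ?_, fun y hy => ?_⟩
  · have hne : y ≠ x := fun h => notMem_of_mem_frontier hΩ hx (h ▸ hy)
    have h1 := contDiffAt_radial (φ x + κ) A 0 hne
    have h2 := infLaplacian_radial (φ x + κ) A 0 hne
    simp only [zero_mul, mul_zero, add_zero] at h1 h2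
    exact supersolutionTestAt_of_contDiffAt h1 (h2.trans_le (hG.nonneg _))
  · linarith [(abs_le.1 (hA y hy)).2]

/-- All admissible functions lie above a common cone with vertex near a given boundary value. -/
theorem exists_cone_le_isAdmissible (hΩ : IsOpen Ω) (hΩb : Bornology.IsBounded Ω)
    (hG : IsBoundedSource G) (hφc : ContinuousOn φ (frontier Ω)) {x : E n} (hx : x ∈ frontier Ω)
    {κ : ℝ} (hκ : 0 < κ) :
    ∃ A, ∀ w, IsAdmissible Ω G φ w → ∀ y ∈ closure Ω, φ x - κ - A * ‖y - x‖ ≤ w y := by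
  obtain ⟨A, hA0, hA⟩ := exists_abs_sub_le_cone (isCompact_frontier hΩb) hφc hx hκ
  obtain ⟨R, hR, hRle⟩ := exists_norm_sub_le_of_isBounded hΩb x
  obtain ⟨m, hm⟩ := hG.bounded
  have hm0 : 0 ≤ m := (hG.nonneg 0).trans (hm 0)
  -- The barrier is this cone plus `‖y - x‖ ^ 2`. Its slope has modulus at least `m + 1`, so its
  -- infinity Laplacian is at least `2 (m + 1)² > m`; the surplus slope absorbs the square on the
  -- boundary. No constant depends on `w`.
  refine ⟨A + 2 * R + m + 1, fun w hw y hy => ?_⟩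
  have hne : ∀ y ∈ Ω, y ≠ x := fun y hy h => notMem_of_mem_frontier hΩ hx (h ▸ hy)
  have := le_of_strict_subsolution hΩ hΩb hw.continuousOn hw.test
    (continuous_radial (φ x - κ) (-(A + 2 * R + m + 1)) 1 x).continuousOn
    (fun y hy => contDiffAt_radial _ _ _ (hne y hy))
    (fun y hy => by
      have h1 := (abs_le.1 (hA y hy)).1
      have h2 := hRle y (frontier_subset_closure hy)
      have h3 := hw.boundary y hy
      have h4 : 0 ≤ ‖y - x‖ * (R - ‖y - x‖) := mul_nonneg (norm_nonneg _) (by linarith)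
      have h5 : 0 ≤ (R + m + 1) * ‖y - x‖ := by positivity
      linarith)
    (fun y hy _ => by
      rw [infLaplacian_radial _ _ _ (hne y hy)]
      refine (hm _).trans_lt ?_
      have h2 := hRle y (subset_closure hy)
      have h3 : m + 1 ≤ A + 2 * R + m + 1 - 2 * ‖y - x‖ := by linarith
      have h4 := pow_le_pow_left₀ (by linarith) h3 2
      have h5 : 0 ≤ m ^ 2 := by positivity
      linarith) y hy
  have h0 : 0 ≤ ‖y - x‖ ^ 2 := by positivity
  linarith

end Comparison

/-! ### Local Lipschitz estimate for upper semicontinuous `∞`-subharmonic functions -/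

section Lipschitz

variable {n : ℕ} {Ω : Set (E n)} {u : E n → ℝ}

/-- Comparison with cones: a cone bent by `-b ‖z - x‖ ^ 2` has negative infinity Laplacian off its
vertex, so `u` minus it has no local maximum in the punctured ball. Then `b → 0`. -/
theorem le_cone_of_infLaplacian_nonneg {M r : ℝ} {x : E n} (hr : 0 < r)
    (husc : UpperSemicontinuousOn u (Metric.closedBall x r))
    (h0 : ∀ y ∈ Metric.closedBall x r, 0 ≤ u y) (hM : ∀ y ∈ Metric.closedBall x r, u y ≤ M)
    (htest : ∀ y ∈ Metric.ball x r, ∀ η : E n → ℝ, ContDiffAt ℝ 2 η y →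
      IsLocalMax (fun z => u z - η z) y → 0 ≤ infLaplacian η y) :
    ∀ y ∈ Metric.closedBall x r, u y ≤ u x + M / r * ‖y - x‖ := by
  intro y hy
  have hxB : x ∈ Metric.closedBall x r := Metric.mem_closedBall_self hr.le
  have hM0 : 0 ≤ M := (h0 x hxB).trans (hM x hxB)
  have key : ∀ b > 0, u y ≤ u x + (M / r + 3 * b * r) * ‖y - x‖ := by
    intro b hb
    -- The surplus `3 * b * r` keeps the bent cone at least `M` on the sphere and its slope positive
    -- throughout the ball.
    set A := M / r + 3 * b * r with hA
    have hAr : A * r = M + 3 * b * r ^ 2 := by rw [hA]; field_simp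
    have hA3 : 3 * b * r ≤ A := by
      have : 0 ≤ M / r := by positivity
      linarith
    set C : E n → ℝ := fun z => u x + A * ‖z - x‖ + (-b) * ‖z - x‖ ^ 2 with hC
    suffices hle : u y ≤ C y by
      have : 0 ≤ b * ‖y - x‖ ^ 2 := by positivity
      simp only [hC] at hle
      linarith
    by_contra! hlt
    have hCc : Continuous C := continuous_radial _ _ _ _
    have husc' : UpperSemicontinuousOn (fun z => u z + -C z) (Metric.closedBall x r) :=
      husc.add hCc.neg.continuousOn.upperSemicontinuousOn
    obtain ⟨z, hz, hmax⟩ := husc'.exists_isMaxOn ⟨y, hy⟩ (isCompact_closedBall x r)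
    have hzpos : 0 < u z - C z := by
      have : u y + -C y ≤ u z + -C z := hmax hy
      linarith
    have hzr : ‖z - x‖ ≤ r := by simpa [dist_eq_norm] using hz
    have hzx : z ≠ x := by
      rintro rfl
      simp [hC] at hzpos
    have hzlt : ‖z - x‖ < r := by
      refine lt_of_le_of_ne hzr fun heq => ?_
      have h1 := hM z hz
      have h2 := h0 x hxB
      have h3 : 0 ≤ b * r ^ 2 := by positivity
      simp only [hC, heq] at hzpos
      linarith
    have hzb : z ∈ Metric.ball x r := by simpa [dist_eq_norm] using hzlt
    have hloc : IsLocalMax (fun y => u y - C y) z := by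
      filter_upwards [Metric.isOpen_ball.mem_nhds hzb] with y' hy'
      have : u y' + -C y' ≤ u z + -C z := hmax (Metric.ball_subset_closedBall hy')
      linarith
    have h1 := htest z hzb C (contDiffAt_radial _ _ _ hzx) hloc
    rw [infLaplacian_radial _ _ _ hzx] at h1
    have h2 : 0 < A + 2 * -b * ‖z - x‖ := by
      have := mul_lt_mul_of_pos_left hzlt hb
      have : 0 < b * r := by positivity
      linarith
    have h3 : 0 < b * (A + 2 * -b * ‖z - x‖) ^ 2 := by positivity
    linarith
  have hlim : Tendsto (fun b : ℝ => u x + (M / r + 3 * b * r) * ‖y - x‖) (𝓝[>] 0)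
      (𝓝 (u x + M / r * ‖y - x‖)) := by
    have : Continuous fun b : ℝ => u x + (M / r + 3 * b * r) * ‖y - x‖ := by fun_prop
    have h := this.tendsto 0
    simp only [mul_zero, zero_mul, add_zero] at h
    exact h.mono_left nhdsWithin_le_nhds
  exact ge_of_tendsto hlim (eventually_mem_nhdsWithin.mono key)

theorem lipschitzOnWith_of_infLaplacian_nonneg {M : ℝ≥0} {r : ℝ≥0} (hr : 0 < r) {K : Set (E n)}
    (hK : ∀ x ∈ K, Metric.closedBall x r ⊆ Ω) (husc : UpperSemicontinuousOn u Ω)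
    (h0 : ∀ y ∈ Ω, 0 ≤ u y) (hM : ∀ y ∈ Ω, u y ≤ M)
    (htest : ∀ y ∈ Ω, ∀ η : E n → ℝ, ContDiffAt ℝ 2 η y →
      IsLocalMax (fun z => u z - η z) y → 0 ≤ infLaplacian η y) :
    LipschitzOnWith (M / r) u K := by
  have hr' : (0 : ℝ) < r := hr
  refine LipschitzOnWith.of_le_add_mul _ fun y hy x hx => ?_
  have hmem : ∀ z ∈ K, z ∈ Ω := fun z hz => hK z hz (Metric.mem_closedBall_self hr'.le)
  push_cast
  by_cases hyx : y ∈ Metric.closedBall x r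
  · have hsub := hK x hx
    rw [dist_eq_norm]
    exact le_cone_of_infLaplacian_nonneg hr' (husc.mono hsub) (fun z hz => h0 z (hsub hz))
      (fun z hz => hM z (hsub hz))
      (fun z hz => htest z (hsub (Metric.ball_subset_closedBall hz))) y hyx
  · have h1 : (r : ℝ) < dist y x := not_le.1 hyx
    have h2 : (M : ℝ) ≤ M / r * dist y x := by
      rw [div_mul_eq_mul_div, le_div_iff₀ hr']
      exact mul_le_mul_of_nonneg_left h1.le M.coe_nonneg
    linarith [hM y (hmem y hy), h0 x (hmem x hx)]

end Lipschitz

end InfSingular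

namespace InfSingular

/-! ### Perron's method -/

section Perron

variable {n : ℕ} {Ω : Set (E n)} {G : ℝ → ℝ} {φ : E n → ℝ}

/-- The infimum of the admissible supersolutions. -/
noncomputable def perron (Ω : Set (E n)) (G : ℝ → ℝ) (φ : E n → ℝ) (x : E n) : ℝ :=
  ⨅ w : {w : E n → ℝ // IsAdmissible Ω G φ w}, w.1 x

/-- The data for which Perron's method is carried out. -/
structure PerronData (Ω : Set (E n)) (G : ℝ → ℝ) (φ : E n → ℝ) : Prop where
  isOpen : IsOpen Ω
  isBounded : Bornology.IsBounded Ω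
  exists_notMem : ∃ z, z ∉ Ω
  source : IsBoundedSource G
  continuousOn : ContinuousOn φ (frontier Ω)
  nonneg : ∀ x ∈ frontier Ω, 0 ≤ φ x

namespace PerronData

variable (D : PerronData Ω G φ)

include D

theorem nonneg_of_isAdmissible {w : E n → ℝ} (hw : IsAdmissible Ω G φ w) {x : E n}
    (hx : x ∈ closure Ω) : 0 ≤ w x :=
  let ⟨_, hz⟩ := D.exists_notMem
  hw.nonneg D.isOpen D.isBounded hz D.source D.nonneg x hx

theorem nonempty_isAdmissible : Nonempty {w : E n → ℝ // IsAdmissible Ω G φ w} := by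
  obtain ⟨M, hM⟩ := (isCompact_frontier D.isBounded).exists_bound_of_continuousOn D.continuousOn
  exact ⟨_, isAdmissible_const D.source fun x hx => (le_abs_self _).trans (hM x hx)⟩

theorem bddBelow {x : E n} (hx : x ∈ closure Ω) :
    BddBelow (range fun w : {w : E n → ℝ // IsAdmissible Ω G φ w} => w.1 x) :=
  ⟨0, by rintro _ ⟨w, rfl⟩; exact D.nonneg_of_isAdmissible w.2 hx⟩

theorem perron_le {w : E n → ℝ} (hw : IsAdmissible Ω G φ w) {x : E n} (hx : x ∈ closure Ω) :
    perron Ω G φ x ≤ w x :=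
  ciInf_le (D.bddBelow hx) ⟨w, hw⟩

theorem le_perron {x : E n} {a : ℝ} (h : ∀ w, IsAdmissible Ω G φ w → a ≤ w x) :
    a ≤ perron Ω G φ x :=
  have := D.nonempty_isAdmissible
  le_ciInf fun w => h w.1 w.2

theorem perron_nonneg {x : E n} (hx : x ∈ closure Ω) : 0 ≤ perron Ω G φ x :=
  D.le_perron fun _ hw => D.nonneg_of_isAdmissible hw hx

theorem exists_isAdmissible_lt {x : E n} {a : ℝ} (h : perron Ω G φ x < a) :
    ∃ w, IsAdmissible Ω G φ w ∧ w x < a := by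
  have := D.nonempty_isAdmissible
  obtain ⟨w, hw⟩ := exists_lt_of_ciInf_lt h
  exact ⟨w.1, w.2, hw⟩

theorem upperSemicontinuousOn_perron : UpperSemicontinuousOn (perron Ω G φ) (closure Ω) :=
  upperSemicontinuousOn_ciInf (fun _ hx => D.bddBelow hx)
    fun w => w.2.continuousOn.upperSemicontinuousOn

/-- On compact sets, one competitor suffices to go below a strict continuous upper bound. -/
theorem exists_isAdmissible_lt_on {K : Set (E n)} (hK : IsCompact K) (hKΩ : K ⊆ closure Ω)
    {g : E n → ℝ} (hg : ContinuousOn g K) (hlt : ∀ y ∈ K, perron Ω G φ y < g y) :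
    ∃ w, IsAdmissible Ω G φ w ∧ ∀ y ∈ K, w y < g y := by
  refine hK.induction_on (p := fun s => ∃ w, IsAdmissible Ω G φ w ∧ ∀ y ∈ s, w y < g y)
    ?_ ?_ ?_ ?_
  · obtain ⟨w, hw⟩ := D.nonempty_isAdmissible
    exact ⟨w, hw, by simp⟩
  · rintro s t hst ⟨w, hw, h⟩
    exact ⟨w, hw, fun y hy => h y (hst hy)⟩
  · rintro s t ⟨w, hw, h⟩ ⟨w', hw', h'⟩
    refine ⟨_, hw.min hw', ?_⟩
    rintro y (hy | hy)
    · exact (min_le_left _ _).trans_lt (h y hy)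
    · exact (min_le_right _ _).trans_lt (h' y hy)
  · intro y hy
    obtain ⟨w, hw, h⟩ := D.exists_isAdmissible_lt (hlt y hy)
    exact ⟨{z | w z < g z},
      ((hw.continuousOn.mono hKΩ) y hy).eventually_lt (hg y hy) h, w, hw, fun z hz => hz⟩

/-- The bump construction: otherwise a competitor could be lowered near the touching point. -/
theorem perron_subsolution_test {x : E n} (hx : x ∈ Ω) {η : E n → ℝ} (hη : ContDiffAt ℝ 2 η x)
    (hmax : IsLocalMax (fun y => perron Ω G φ y - η y) x) :
    G (perron Ω G φ x) ≤ infLaplacian η x := by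
  set u := perron Ω G φ with hu
  by_contra! hlt
  set g : E n → ℝ := fun y => η y + (u x - η x + 1 * (‖y - x‖ ^ 2) ^ 2) with hg
  have hgx : g x = u x := by simp [hg]
  have hgc : ContDiffAt ℝ 2 g x := hη.add (contDiff_quartic _ _ _).contDiffAt
  obtain ⟨a, ha1, ha2⟩ := exists_between hlt
  rw [← infLaplacian_add_quartic hη (u x - η x) 1] at ha1
  obtain ⟨τ, hτ, hGτ⟩ := Metric.eventually_nhds_iff.1
    (D.source.continuous.continuousAt.eventually_const_lt ha2)
  have hev : ∀ᶠ y in 𝓝 x, ContDiffAt ℝ 2 g y ∧ infLaplacian g y < a ∧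
      dist (g y) (u x) < τ / 2 ∧ u y - η y ≤ u x - η x ∧ y ∈ Ω := by
    refine (hgc.eventually (by simp)).and (((continuousAt_infLaplacian hgc).eventually_lt_const
      ha1).and (Eventually.and ?_ (Eventually.and hmax (D.isOpen.mem_nhds hx))))
    have := Metric.tendsto_nhds.1 hgc.continuousAt (τ / 2) (by positivity)
    rwa [hgx] at this
  obtain ⟨r, hr, hball⟩ := Metric.nhds_basis_closedBall.eventually_iff.1 hev
  -- `κ < τ / 2` keeps the source above `a` at `g - κ`; `κ < (r / 2)⁴` keeps the infimum below `g -
  -- κ` on the annulus.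
  set κ := min (τ / 2) (((r / 2) ^ 2) ^ 2) / 2 with hκ
  have hκ0 : 0 < κ := by positivity
  have hκτ : κ < τ / 2 := by
    have := min_le_left (τ / 2) (((r / 2) ^ 2) ^ 2)
    have : (0 : ℝ) < min (τ / 2) (((r / 2) ^ 2) ^ 2) := by positivity
    linarith
  have hκr : κ < ((r / 2) ^ 2) ^ 2 := by
    have := min_le_right (τ / 2) (((r / 2) ^ 2) ^ 2)
    have : (0 : ℝ) < min (τ / 2) (((r / 2) ^ 2) ^ 2) := by positivity
    linarith
  have hballΩ : Metric.closedBall x r ⊆ Ω := fun y hy => (hball hy).2.2.2.2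
  have hgB : ContinuousOn g (Metric.closedBall x r) := fun y hy =>
    (hball hy).1.continuousAt.continuousWithinAt
  -- The infimum is not yet known to be continuous, so a competitor `w` is lowered instead. Being
  -- below `g - κ` on the annulus, it glues with `min w (g - κ)`.
  obtain ⟨w, hw, hwlt⟩ := D.exists_isAdmissible_lt_on
    (K := Metric.closedBall x r \ Metric.ball x (r / 2)) (g := fun y => g y - κ)
    ((isCompact_closedBall x r).diff Metric.isOpen_ball)
    (sdiff_subset.trans (hballΩ.trans subset_closure))
    ((hgB.mono sdiff_subset).sub continuousOn_const) (by
      rintro y ⟨hy, hy'⟩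
      have h1 := (hball hy).2.2.2.1
      have h2 : r / 2 ≤ ‖y - x‖ := by
        rw [← dist_eq_norm]
        exact not_lt.1 hy'
      have h3 : ((r / 2) ^ 2) ^ 2 ≤ (‖y - x‖ ^ 2) ^ 2 := by gcongr
      simp only [hg]
      linarith)
  classical
  set v : E n → ℝ := fun y => if dist y x < r then min (w y) (g y - κ) else w y with hv
  have hin : ∀ y, dist y x < r → v y = min (w y) (g y - κ) := fun y hy => if_pos hy
  have hout : ∀ y, r / 2 < dist y x → v y = w y := by
    intro y hy
    by_cases h : dist y x < r
    · rw [hin y h]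
      exact min_eq_left (hwlt y ⟨h.le, not_lt.2 hy.le⟩).le
    · exact if_neg h
  have hin' : ∀ y, dist y x < r → v =ᶠ[𝓝 y] fun z => min (w z) (g z - κ) := by
    intro y hy
    filter_upwards [Metric.isOpen_ball.mem_nhds (show y ∈ Metric.ball x r from hy)] with z hz
      using hin z hz
  have hout' : ∀ y, r / 2 < dist y x → v =ᶠ[𝓝 y] w := by
    intro y hy
    filter_upwards [(isOpen_lt continuous_const (continuous_id.dist continuous_const)).mem_nhds hy]
      with z hz using hout z hz
  have hcases : ∀ y, dist y x < r ∨ r / 2 < dist y x := fun y => by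
    rcases lt_or_ge (dist y x) r with h | h
    · exact Or.inl h
    · exact Or.inr (by linarith)
  have hvad : IsAdmissible Ω G φ v := by
    refine ⟨fun y hy => ?_, fun y hy => ?_, fun y hy => ?_⟩
    · rcases hcases y with h | h
      · refine ContinuousWithinAt.congr_of_eventuallyEq ?_
          ((hin' y h).filter_mono nhdsWithin_le_nhds) (hin y h)
        exact (hw.continuousOn y hy).inf
          (((hball (Metric.mem_closedBall.2 h.le)).1.continuousAt.sub
            continuousAt_const).continuousWithinAt)
      · exact (hw.continuousOn y hy).congr_of_eventuallyEq
          ((hout' y h).filter_mono nhdsWithin_le_nhds) (hout y h)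
    · rcases hcases y with h | h
      · refine SupersolutionTestAt.congr ((hw.test y hy).min ?_) (hin' y h)
        obtain ⟨h1, h2, h3, -⟩ := hball (Metric.mem_closedBall.2 h.le)
        refine supersolutionTestAt_of_contDiffAt (h1.sub contDiffAt_const) ?_
        have h4 : infLaplacian (fun z => g z - κ) y = infLaplacian g y := by
          have : fderiv ℝ (fun z => g z - κ) = fderiv ℝ g := by
            funext z
            exact fderiv_sub_const κ
          simp only [infLaplacian, this]
        rw [h4]
        refine h2.le.trans (hGτ ?_).le
        rw [Real.dist_eq, abs_lt] at h3 ⊢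
        constructor <;> linarith
      · exact (hw.test y hy).congr (hout' y h)
    · have h : r / 2 < dist y x := by
        by_contra! h
        exact notMem_of_mem_frontier D.isOpen hy
          (hballΩ (Metric.mem_closedBall.2 (by linarith)))
      rw [hout y h]
      exact hw.boundary y hy
  have h1 := D.perron_le hvad (subset_closure hx)
  rw [hin x (by simpa using hr)] at h1
  have h2 := h1.trans (min_le_right _ _)
  rw [hgx] at h2
  linarith

/-- The infimum of the supersolutions passes the supersolution test. -/
theorem perron_supersolution_test {x : E n} (hx : x ∈ Ω) :
    SupersolutionTestAt G (perron Ω G φ) x := by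
  intro η hη hmin
  set u := perron Ω G φ with hu
  by_contra! hlt
  set g : E n → ℝ := fun y => η y + (0 + (-1) * (‖y - x‖ ^ 2) ^ 2) with hg
  have hgx : g x = η x := by simp [hg]
  have hgc : ContDiffAt ℝ 2 g x := hη.add (contDiff_quartic _ _ _).contDiffAt
  obtain ⟨a, ha1, ha2⟩ := exists_between hlt
  rw [← infLaplacian_add_quartic hη 0 (-1)] at ha2
  obtain ⟨τ, hτ, hGτ⟩ := Metric.eventually_nhds_iff.1
    (D.source.continuous.continuousAt.eventually_lt_const ha1)
  have hev : ∀ᶠ y in 𝓝 x, ContDiffAt ℝ 2 g y ∧ a < infLaplacian g y ∧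
      dist (g y) (η x) < τ / 2 ∧ u x - η x ≤ u y - η y ∧ y ∈ Ω := by
    refine (hgc.eventually (by simp)).and (((continuousAt_infLaplacian hgc).eventually_const_lt
      ha2).and (Eventually.and ?_ (Eventually.and hmin (D.isOpen.mem_nhds hx))))
    have := Metric.tendsto_nhds.1 hgc.continuousAt (τ / 2) (by positivity)
    rwa [hgx] at this
  obtain ⟨r, hr, hball⟩ := Metric.nhds_basis_closedBall.eventually_iff.1 hev
  -- A competitor within `κ` of the infimum at `x` suffices: the quartic gap on the sphere forces
  -- the minimum of `w - g` inside the ball, and `w` there is within `τ` of the infimum at `x`.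
  set κ := min (τ / 2) ((r ^ 2) ^ 2) with hκ
  have hκ0 : 0 < κ := by positivity
  have hκτ : κ ≤ τ / 2 := min_le_left _ _
  have hκr : κ ≤ (r ^ 2) ^ 2 := min_le_right _ _
  have hballΩ : Metric.closedBall x r ⊆ Ω := fun y hy => (hball hy).2.2.2.2
  have hgB : ContinuousOn g (Metric.closedBall x r) := fun y hy =>
    (hball hy).1.continuousAt.continuousWithinAt
  have hxB : x ∈ Metric.closedBall x r := Metric.mem_closedBall_self hr.le
  obtain ⟨w, hw, hwx⟩ := D.exists_isAdmissible_lt (show u x < u x + κ by linarith)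
  obtain ⟨z, hz, hzmin⟩ := (isCompact_closedBall x r).exists_isMinOn ⟨x, hxB⟩
    ((hw.continuousOn.mono (hballΩ.trans subset_closure)).sub hgB)
  have hzx : w z - g z ≤ w x - g x := hzmin hxB
  obtain ⟨h1, h2, h3, h4, h5⟩ := hball hz
  have h6 : u z ≤ w z := D.perron_le hw (subset_closure h5)
  have hgz : g z = η z - (‖z - x‖ ^ 2) ^ 2 := by simp only [hg]; ring
  have hzr : ‖z - x‖ < r := by
    by_contra! h
    have : (r ^ 2) ^ 2 ≤ (‖z - x‖ ^ 2) ^ 2 := by gcongr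
    linarith
  have hloc : IsLocalMin (fun y => w y - g y) z := by
    have hzb : z ∈ Metric.ball x r := by rwa [Metric.mem_ball, dist_eq_norm]
    filter_upwards [Metric.isOpen_ball.mem_nhds hzb] with y hy
      using hzmin (Metric.ball_subset_closedBall hy)
  have h7 := hw.test z h5 g h1 hloc
  have h8 : G (w z) < a := by
    refine hGτ ?_
    have h9 : 0 ≤ (‖z - x‖ ^ 2) ^ 2 := by positivity
    rw [Real.dist_eq, abs_lt] at h3 ⊢
    constructor <;> linarith
  linarith

/-- The constant `M` is a competitor, and only the sign of the source enters, so its size does not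
affect the estimate. -/
theorem lipschitzOnWith_perron {M r : ℝ≥0} (hr : 0 < r) {K : Set (E n)}
    (hK : ∀ x ∈ K, Metric.closedBall x r ⊆ Ω) (hM : ∀ x ∈ frontier Ω, φ x ≤ M) :
    LipschitzOnWith (M / r) (perron Ω G φ) K :=
  lipschitzOnWith_of_infLaplacian_nonneg hr hK
    (D.upperSemicontinuousOn_perron.mono subset_closure)
    (fun _ hy => D.perron_nonneg (subset_closure hy))
    (fun _ hy => D.perron_le (isAdmissible_const D.source hM) (subset_closure hy))
    (fun _ hy _ hη hmax => (D.source.nonneg _).trans (D.perron_subsolution_test hy hη hmax))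

theorem continuousAt_perron {x : E n} (hx : x ∈ Ω) : ContinuousAt (perron Ω G φ) x := by
  obtain ⟨M, hM⟩ := (isCompact_frontier D.isBounded).exists_bound_of_continuousOn D.continuousOn
  obtain ⟨r, hr, hball⟩ := Metric.nhds_basis_closedBall.mem_iff.1 (D.isOpen.mem_nhds hx)
  have hr2 : 0 < r / 2 := by positivity
  have hL := D.lipschitzOnWith_perron (M := M.toNNReal) (r := (r / 2).toNNReal)
    (K := Metric.ball x (r / 2)) (by simpa using hr) (by
      intro y hy z hz
      refine hball ?_
      rw [Real.coe_toNNReal _ hr2.le] at hz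
      have := dist_triangle z y x
      simp only [Metric.mem_closedBall, Metric.mem_ball] at *
      linarith)
    (fun y hy => (le_abs_self _).trans ((hM y hy).trans (Real.le_coe_toNNReal M)))
  exact hL.continuousOn.continuousAt (Metric.ball_mem_nhds x hr2)

theorem exists_abs_perron_sub_le {x : E n} (hx : x ∈ frontier Ω) {κ : ℝ} (hκ : 0 < κ) :
    ∃ A, ∀ y ∈ closure Ω, |perron Ω G φ y - φ x| ≤ κ + A * ‖y - x‖ := by
  obtain ⟨A, hA⟩ := exists_isAdmissible_cone D.isOpen D.isBounded D.source D.continuousOn hx hκ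
  obtain ⟨A', hA'⟩ :=
    exists_cone_le_isAdmissible D.isOpen D.isBounded D.source D.continuousOn hx hκ
  refine ⟨max A A', fun y hy => ?_⟩
  have h1 := D.perron_le hA hy
  have h2 := D.le_perron fun w hw => hA' w hw y hy
  have h3 : A * ‖y - x‖ ≤ max A A' * ‖y - x‖ := by gcongr; exact le_max_left _ _
  have h4 : A' * ‖y - x‖ ≤ max A A' * ‖y - x‖ := by gcongr; exact le_max_right _ _
  rw [abs_le]
  constructor <;> linarith

theorem perron_eq_of_mem_frontier {x : E n} (hx : x ∈ frontier Ω) : perron Ω G φ x = φ x := by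
  refine eq_of_abs_sub_nonpos (le_of_forall_pos_le_add fun κ hκ => ?_)
  obtain ⟨A, hA⟩ := D.exists_abs_perron_sub_le hx hκ
  simpa using hA x (frontier_subset_closure hx)

theorem continuousOn_perron : ContinuousOn (perron Ω G φ) (closure Ω) := by
  intro x hx
  by_cases hxΩ : x ∈ Ω
  · exact (D.continuousAt_perron hxΩ).continuousWithinAt
  · have hxf := mem_frontier_of_notMem D.isOpen hx hxΩ
    refine Metric.tendsto_nhds.2 fun κ hκ => ?_
    obtain ⟨A, hA⟩ := D.exists_abs_perron_sub_le hxf (half_pos hκ)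
    have hc : ContinuousAt (fun y => κ / 2 + A * ‖y - x‖) x := by fun_prop
    have hlt : ∀ᶠ y in 𝓝[closure Ω] x, κ / 2 + A * ‖y - x‖ < κ :=
      (hc.eventually_lt_const (by simpa using hκ)).filter_mono nhdsWithin_le_nhds
    filter_upwards [hlt, self_mem_nhdsWithin] with y hy hyΩ
    rw [D.perron_eq_of_mem_frontier hxf, Real.dist_eq]
    exact (hA y hyΩ).trans_lt hy

theorem isMinimalSolution_perron : IsMinimalSolution Ω G φ (perron Ω G φ) where
  continuousOn := D.continuousOn_perron
  subsolution := ⟨D.continuousOn_perron.mono subset_closure,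
    fun _ hx _ hη hmax => D.perron_subsolution_test hx hη hmax⟩
  supersolution := ⟨D.continuousOn_perron.mono subset_closure,
    fun _ hx => D.perron_supersolution_test hx⟩
  boundary _ hx := D.perron_eq_of_mem_frontier hx
  minimal _ hwc hw hwb _ hx := D.perron_le ⟨hwc, hw.2, hwb⟩ hx

end PerronData

end Perron

/-! ### The penalized source term -/

section Source

/-- The profile vanishes up to `c = δ ε^α / 2`, which removes the singularity; beyond it `c ^ (-γ)`
is a bound. This bound depends on `ε` but is used only in the lower boundary barrier. -/
theorem isBoundedSource_penalizedSource {γ δ ε : ℝ} {B : ℝ → ℝ} (hγ : 0 ≤ γ) (hδ : 0 < δ)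
    (hε : 0 < ε) (hB : IsPenalizationProfile δ B) : IsBoundedSource (penalizedSource γ B ε) := by
  set a := ε ^ (4 / (3 + γ)) with ha
  have ha0 : 0 < a := Real.rpow_pos_of_pos hε _
  set c := δ / 2 * a with hc
  have hc0 : 0 < c := by positivity
  have hzero : ∀ s, s ≤ c → penalizedSource γ B ε s = 0 := by
    intro s hs
    have : s / a ≤ δ / 2 := (div_le_iff₀ ha0).2 hs
    simp [penalizedSource, ← ha, hB.eq_zero _ this]
  have hpos : ∀ s, c < s → 0 ≤ B (s / a) ∧ B (s / a) ≤ 1 := fun s hs =>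
    hB.mem_Icc _ (div_nonneg (hc0.trans hs).le ha0.le)
  obtain ⟨L, hL⟩ := hB.lipschitz
  refine ⟨continuous_iff_continuousAt.2 fun s => ?_, fun s => ?_, ⟨c ^ (-γ), fun s => ?_⟩,
    fun s hs => hzero s (hs.trans hc0.le)⟩
  · rcases lt_or_ge s c with h | h
    · have : penalizedSource γ B ε =ᶠ[𝓝 s] fun _ => 0 := by
        filter_upwards [gt_mem_nhds h] with t ht using hzero t ht.le
      exact continuousAt_const.congr this.symm
    · have h1 : ContinuousAt (fun s => B (s / a)) s :=
        (hL.continuous.comp (continuous_id.div_const a)).continuousAt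
      exact h1.mul (Real.continuousAt_rpow_const s (-γ) (Or.inl (hc0.trans_le h).ne'))
  · rcases le_or_gt s c with h | h
    · rw [hzero s h]
    · exact mul_nonneg (hpos s h).1 (Real.rpow_nonneg (hc0.trans h).le _)
  · rcases le_or_gt s c with h | h
    · rw [hzero s h]
      exact Real.rpow_nonneg hc0.le _
    · calc penalizedSource γ B ε s ≤ 1 * s ^ (-γ) :=
            mul_le_mul_of_nonneg_right (hpos s h).2 (Real.rpow_nonneg (hc0.trans h).le _)
        _ = s ^ (-γ) := one_mul _
        _ ≤ c ^ (-γ) := Real.rpow_le_rpow_of_nonpos hc0 h.le (by linarith)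

end Source

/-- Provides the vertex of the paraboloid in `IsAdmissible.nonneg`; `ℝ⁰` is itself bounded, hence `1
≤ n`. -/
theorem exists_notMem_of_isBounded {n : ℕ} (hn : 1 ≤ n) {Ω : Set (E n)}
    (hΩ : Bornology.IsBounded Ω) : ∃ z, z ∉ Ω := by
  have : Nonempty (Fin n) := ⟨⟨0, hn⟩⟩
  by_contra! h
  rw [eq_univ_of_forall h] at hΩ
  exact NormedSpace.unbounded_univ ℝ (E n) hΩ

end InfSingular

open InfSingular in
theorem theorem2p3 (n : ℕ) (hn : 1 ≤ n) (Ω : Set (E n)) (hΩ : IsBoundedSmoothDomain Ω)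
    (γ : ℝ) (hγ0 : 0 ≤ γ) (hγ1 : γ < 1)
    (δ : ℝ) (hδ : 0 < δ) (B : ℝ → ℝ) (hB : IsPenalizationProfile δ B)
    (φ : ℝ → E n → ℝ) (hφW : ∀ ε, 0 < ε → MemW2InfBoundary Ω (φ ε))
    (hφ0 : ∀ ε, 0 < ε → ∀ x ∈ frontier Ω, 0 ≤ φ ε x) :
    ∃ u : ℝ → E n → ℝ,
      (∀ ε, 0 < ε →
        IsMinimalSolution Ω (penalizedSource γ B ε) (φ ε) (u ε) ∧
        ∀ x ∈ closure Ω, 0 ≤ u ε x) ∧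
      ∀ S : Set ℝ, S ⊆ Set.Ioi 0 →
        (∃ M : ℝ, ∀ ε ∈ S, ∀ x ∈ frontier Ω, φ ε x ≤ M) →
        LocallyEquiLipschitzOn Ω S u := by
  have D : ∀ ε, 0 < ε → PerronData Ω (penalizedSource γ B ε) (φ ε) := fun ε hε =>
    { isOpen := hΩ.isOpen
      isBounded := hΩ.isBounded
      exists_notMem := exists_notMem_of_isBounded hn hΩ.isBounded
      source := isBoundedSource_penalizedSource hγ0 hδ hε hB
      continuousOn := (hφW ε hε).1
      nonneg := hφ0 ε hε }
  refine ⟨fun ε => perron Ω (penalizedSource γ B ε) (φ ε), fun ε hε =>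
    ⟨(D ε hε).isMinimalSolution_perron, fun x hx => (D ε hε).perron_nonneg hx⟩, ?_⟩
  rintro S hS ⟨M, hM⟩ K hK hKΩ
  -- `r` depends only on `K` and `Ω`, so one constant serves all `ε ∈ S`.
  obtain ⟨r, hr, hthick⟩ := hK.exists_cthickening_subset_open hΩ.isOpen hKΩ
  refine ⟨M.toNNReal / r.toNNReal, fun ε hε => ?_⟩
  refine (D ε (hS hε)).lipschitzOnWith_perron (by simpa using hr) (fun x hx => ?_)
    fun x hx => (hM ε hε x hx).trans (Real.le_coe_toNNReal M)
  rw [Real.coe_toNNReal _ hr.le]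
  exact (Metric.closedBall_subset_cthickening hx r).trans hthick
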